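/- Let $n,k$ be positive integers and $\rho=(\rho_1,\dots,\rho_k)$ integers with $1\le\rho_\ell\le n\le k$ for all $\ell\in[k]=\{1,\dots,k\}$ and $\sum_{\ell=1}^k\rho_\ell=n^2$. Let $0\le r\le n$. An $r\times r$ *$\rho$-latin rectangle* is an $r\times r$ array, every cell of which contains a symbol from $[k]$, such that each symbol occurs at most once in each row and at most once in each column, and symbol $\ell$ occurs at most $\rho_\ell$ times for every $\ell\in[k]$. An $n\times n$ *$\rho$-latin square* is an $n\times n$ array filled with symbols from $[k]$ such that each symbol occurs at most once in each row and at most once in each column, and symbol $\ell$ occurs exactly $\rho_\ell$ times for every $\ell\in[k]$. A square array $A$ is *symmetric* if $A_{ij}=A_{ji}$ for all $i,j$. Let $L$ be a symmetric $r\times r$ $\rho$-latin rectangle. Let $e_\ell$ be the number of occurrences of $\ell$ in $L$. For $I\subseteq[r]$ and $\ell\in[k]$ let $\mu_I(\ell)$ be the number of rows in $I$ in which symbol $\ell$ is missing, and for $K\subseteq[k]$ and $i\in[r]$ let $\mu_K(i)$ be the number of symbols in $K$ that are missing in row $i$ of $L$. Write $x\mathbin{\dot-}y=\max\{0,x-y\}$,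 where $\dot-$ binds more weakly than $+$ and $-$, and $\bar K=[k]\setminus K$. Call $L$ *$\rho$-admissible* if (1) $\rho_\ell-e_\ell\le 2(n-r)$ for all $\ell\in[k]$; (2) $|\{\ell\in[k]:\rho_\ell\not\equiv e_\ell \pmod 2\}|\le n-r$; (3) $n-r\equiv\sum_{\ell\in[k]}(\rho_\ell-e_\ell)\equiv|\{\ell\in[k]:\rho_\ell\not\equiv e_\ell \pmod 2\}| \pmod 2$. Consider the conditions (4) $(n-r)|I|\le\sum_{\ell\in[k]}\min\{\lfloor(\rho_\ell-e_\ell)/2\rfloor,\ \mu_I(\ell)\}$ for all $I\subseteq[r]$; (5) $\sum_{\ell\in K}(\rho_\ell-e_\ell+r\mathbin{\dot-}n)\le\sum_{i\in[r]}\min\{n-r,\ \mu_K(i)\}$ for all $K\subseteq[k]$; (6) $(n-r)(r-|I|)+\sum_{\ell\in\bar K}\lfloor(\rho_\ell-e_\ell)/2\rfloor\ \ge\ \sum_{\ell\in K}\big(\rho_\ell-e_\ell-n+r\mathbin{\dot-}\mu_I(\ell)\big)+\sum_{i\in I}\big(n-r\mathbin{\dot-}\mu_K(i)\big)$ for all $I\subseteq[r]$,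 $K\subseteq[k]$. **Theorem.** $L$ can be completed to a symmetric $n\times n$ $\rho$-latin square (that is, some symmetric $n\times n$ $\rho$-latin square has $L$ as its top left $r\times r$ subarray) if and only if $L$ is $\rho$-admissible and either both (4) and (5) hold, or (6) holds. Moreover, either alternative alone suffices and is necessary: $L$ can be completed if and only if $L$ is $\rho$-admissible and (4) and (5) hold, and $L$ can be completed if and only if $L$ is $\rho$-admissible and (6) holds. -/

import Mathlib

namespace RhoLatin

/-- `occ L ℓ` is the number of cells of the array `L` that contain the symbol `ℓ`. -/
def occ {r s k : ℕ} (L : Matrix (Fin r) (Fin s) (Fin k)) (ℓ : Fin k) : ℕ :=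
  (Finset.univ.filter fun c : Fin r × Fin s => L c.1 c.2 = ℓ).card

/-- An `r × s` array on `k` symbols is a `ρ`-latin rectangle if every symbol occurs at most once
in each row, at most once in each column, and the symbol `ℓ` occurs at most `ρ ℓ` times. -/
structure IsRhoLatinRectangle {r s k : ℕ} (ρ : Fin k → ℕ)
    (L : Matrix (Fin r) (Fin s) (Fin k)) : Prop where
  row : ∀ i, Function.Injective fun j => L i j
  col : ∀ j, Function.Injective fun i => L i j
  occ_le : ∀ ℓ, occ L ℓ ≤ ρ ℓ

/-- An `n × n` array on `k` symbols is a `ρ`-latin square if every symbol occurs at most once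
in each row, at most once in each column, and the symbol `ℓ` occurs exactly `ρ ℓ` times. -/
structure IsRhoLatinSquare {n k : ℕ} (ρ : Fin k → ℕ)
    (L : Matrix (Fin n) (Fin n) (Fin k)) : Prop where
  row : ∀ i, Function.Injective fun j => L i j
  col : ∀ j, Function.Injective fun i => L i j
  occ_eq : ∀ ℓ, occ L ℓ = ρ ℓ

/-- The `r × r` array `L` can be completed to a symmetric `n × n` `ρ`-latin square: some symmetric
`ρ`-latin square of order `n` has `L` as its top left `r × r` subarray. -/
def CompletesToSymmetric {r n k : ℕ} (hrn : r ≤ n) (ρ : Fin k → ℕ)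
    (L : Matrix (Fin r) (Fin r) (Fin k)) : Prop :=
  ∃ L' : Matrix (Fin n) (Fin n) (Fin k),
    IsRhoLatinSquare ρ L' ∧ L'.IsSymm ∧
      L'.submatrix (Fin.castLE hrn) (Fin.castLE hrn) = L

/-- The symbol `ℓ` is missing in row `i` of `L`. -/
def IsMissing {r k : ℕ} (L : Matrix (Fin r) (Fin r) (Fin k)) (i : Fin r) (ℓ : Fin k) : Prop :=
  ∀ j, L i j ≠ ℓ

instance {r k : ℕ} (L : Matrix (Fin r) (Fin r) (Fin k)) (i : Fin r) (ℓ : Fin k) :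
    Decidable (IsMissing L i ℓ) :=
  inferInstanceAs (Decidable (∀ j, L i j ≠ ℓ))

/-- `missingSymbols L K i` is the number of symbols in `K` that are missing in row `i`. -/
def missingSymbols {r k : ℕ} (L : Matrix (Fin r) (Fin r) (Fin k))
    (K : Finset (Fin k)) (i : Fin r) : ℕ :=
  (K.filter fun ℓ => IsMissing L i ℓ).card

/-- `missingRows L I ℓ` is the number of rows in `I` in which the symbol `ℓ` is missing. -/
def missingRows {r k : ℕ} (L : Matrix (Fin r) (Fin r) (Fin k))
    (I : Finset (Fin r)) (ℓ : Fin k) : ℕ :=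
  (I.filter fun i => IsMissing L i ℓ).card

/-- Truncated subtraction `max {0, x - y}` of integers. -/
def dotdiv (x y : ℤ) : ℤ := max 0 (x - y)

/-- The number of symbols `ℓ` such that `ρ ℓ` and the number of occurrences of `ℓ` in `L` have
different parity. -/
def oddCount {r k : ℕ} (ρ : Fin k → ℕ) (L : Matrix (Fin r) (Fin r) (Fin k)) : ℕ :=
  (Finset.univ.filter fun ℓ : Fin k => ¬ ρ ℓ ≡ occ L ℓ [MOD 2]).card

/-- `ρ`-admissibility of an `r × r` array with respect to the order `n`. -/
structure IsAdmissible {r k : ℕ} (n : ℕ) (ρ : Fin k → ℕ)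
    (L : Matrix (Fin r) (Fin r) (Fin k)) : Prop where
  sub_le : ∀ ℓ, (ρ ℓ : ℤ) - occ L ℓ ≤ 2 * ((n : ℤ) - r)
  oddCount_le : (oddCount ρ L : ℤ) ≤ (n : ℤ) - r
  modEq_sum : (n : ℤ) - r ≡ ∑ ℓ, ((ρ ℓ : ℤ) - occ L ℓ) [ZMOD 2]
  sum_modEq : ∑ ℓ, ((ρ ℓ : ℤ) - occ L ℓ) ≡ (oddCount ρ L : ℤ) [ZMOD 2]

/-- The inequality indexed by sets of rows (`/` on `ℤ` with divisor `2` is the floor of the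
quotient). -/
def RowCondition {r k : ℕ} (n : ℕ) (ρ : Fin k → ℕ)
    (L : Matrix (Fin r) (Fin r) (Fin k)) : Prop :=
  ∀ I : Finset (Fin r),
    ((n : ℤ) - r) * I.card ≤
      ∑ ℓ, min (((ρ ℓ : ℤ) - occ L ℓ) / 2) (missingRows L I ℓ : ℤ)

/-- The inequality indexed by sets of symbols. -/
def SymbolCondition {r k : ℕ} (n : ℕ) (ρ : Fin k → ℕ)
    (L : Matrix (Fin r) (Fin r) (Fin k)) : Prop :=
  ∀ K : Finset (Fin k),
    ∑ ℓ ∈ K, dotdiv ((ρ ℓ : ℤ) - occ L ℓ + r) n ≤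
      ∑ i, min ((n : ℤ) - r) (missingSymbols L K i : ℤ)

/-- The inequality indexed by pairs of a set of rows and a set of symbols (`/` on `ℤ` with
divisor `2` is the floor of the quotient). -/
def MixedCondition {r k : ℕ} (n : ℕ) (ρ : Fin k → ℕ)
    (L : Matrix (Fin r) (Fin r) (Fin k)) : Prop :=
  ∀ (I : Finset (Fin r)) (K : Finset (Fin k)),
    ∑ ℓ ∈ K, dotdiv ((ρ ℓ : ℤ) - occ L ℓ - n + r) (missingRows L I ℓ) +
        ∑ i ∈ I, dotdiv ((n : ℤ) - r) (missingSymbols L K i) ≤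
      ((n : ℤ) - r) * ((r : ℤ) - I.card) + ∑ ℓ ∈ Kᶜ, ((ρ ℓ : ℤ) - occ L ℓ) / 2

end RhoLatin

/-!
Write `m = n - r` and let `a ℓ = ρ ℓ - e ℓ` be the number of occurrences of `ℓ` still to be placed.
A symmetric completion of `L` is determined by its top right `r × m` block and its bottom right
`m × m` block. The proof records of the first block only the numbers `x i ℓ` of occurrences of `ℓ`
in its row `i`; they form a 0/1 matrix supported on the pairs for which `ℓ` is missing in row `i`,
with row sums `m` and with column sums between `a ℓ - m` and `a ℓ / 2` (`IsRowExtension`). Every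
completion yields such a matrix, by counting in blocks. Admissibility follows from the same counts
and the remark that a symbol occurring an odd number of times in a symmetric array occurs on its
diagonal.

Such a matrix exists exactly if the cut condition of a flow network with a source-sink, the rows
and the symbols holds. This follows from Hoffman's circulation theorem (`exists_circulation`), which
is proved by shrinking the bounds of the arcs, using submodularity of the cut function. The cuts not
containing the source-sink give the symbol condition, and those containing it the row condition
(`exists_matrix_of_cut_conditions`). In the mixed condition the two are added; it is equivalent to
their conjunction by choosing one of its two sets to be everything (`mixedCondition_iff`).

Conversely, let `x` be given. The remaining multiplicities `a ℓ - 2 ∑ i, x i ℓ` add up to `m ^ 2`,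
and at most `m` of them are odd. Hence they split into `t ℓ` diagonal cells and `c ℓ` symmetric
pairs of the bottom right block, with the correct totals (`IsAmalgam`). Regard the `m` new rows as
a single amalgamated row, in which each symbol occurs at most `m` times. One row is split off by
rounding the multiplicities divided by `m` to an integral solution of the transportation problem
they solve (`exists_rounding`): this chooses one symbol for each old column, one for the diagonal
cell, and `m - 1` for the rest of the new row, all distinct and including every symbol that occurs
`m` times in the amalgamated row. What remains is an amalgam with `m - 1` in place of `m`
(`IsAmalgam.exists_border`), so that induction completes the square.
-/

namespace RhoLatin

open Finset

/-! ### Integral circulations -/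

/-- The upper bounds of the arcs entering `S` minus the lower bounds of the arcs leaving `S`. -/
def cutSlack {V : Type*} [Fintype V] [DecidableEq V] (l u : V → V → ℤ) (S : Finset V) : ℤ :=
  ∑ x, ∑ y, if x ∈ S then (if y ∈ S then 0 else -l x y) else (if y ∈ S then u x y else 0)

section Circulation

variable {V : Type*} [Fintype V] [DecidableEq V]

theorem cutSlack_eq_of_fun_eq (l : V → V → ℤ) (v : V) :
    cutSlack l l {v} = ∑ x, l x v - ∑ y, l v y := by
  have h : ∀ x y, (if x ∈ ({v} : Finset V) then (if y ∈ ({v} : Finset V) then 0 else -l x y)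
      else (if y ∈ ({v} : Finset V) then l x y else 0)) =
      (if y = v then l x y else 0) - (if x = v then l x y else 0) := by
    intro x y
    by_cases hx : x = v <;> by_cases hy : y = v <;> simp [hx, hy]
  unfold cutSlack
  simp only [h, sum_sub_distrib]
  congr 1
  · simp
  · rw [sum_comm]; simp

theorem cutSlack_compl_of_fun_eq (l : V → V → ℤ) (S : Finset V) :
    cutSlack l l Sᶜ = -cutSlack l l S := by
  unfold cutSlack
  simp only [← sum_neg_distrib]
  refine sum_congr rfl fun x _ => sum_congr rfl fun y _ => ?_
  by_cases hx : x ∈ S <;> by_cases hy : y ∈ S <;> simp [hx, hy]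

/-- Submodularity of the slack, with the gain caused by an arc from `S \ T` to `T \ S`. -/
theorem cutSlack_inter_add_cutSlack_union_le {l u : V → V → ℤ} (hlu : ∀ x y, l x y ≤ u x y)
    {S T : Finset V} {a b : V} (haS : a ∈ S) (hbS : b ∉ S) (haT : a ∉ T) (hbT : b ∈ T) :
    cutSlack l u (S ∩ T) + cutSlack l u (S ∪ T) + (u a b - l a b) ≤
      cutSlack l u S + cutSlack l u T := by
  have hab : u a b - l a b = ∑ x, ∑ y, if x = a ∧ y = b then u x y - l x y else 0 := by
    simp [ite_and]
  rw [hab]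
  clear hab
  unfold cutSlack
  simp only [← sum_add_distrib]
  refine sum_le_sum fun x _ => sum_le_sum fun y _ => ?_
  have := hlu x y
  by_cases hxy : x = a ∧ y = b
  · obtain ⟨rfl, rfl⟩ := hxy
    simp [haS, hbS, haT, hbT]
  · by_cases h1 : x ∈ S <;> by_cases h2 : y ∈ S <;> by_cases h3 : x ∈ T <;>
      by_cases h4 : y ∈ T <;> simp [h1, h2, h3, h4, hxy] <;> linarith

theorem cutSlack_add_lower (l u : V → V → ℤ) (a b : V) (S : Finset V) :
    cutSlack (fun x y => l x y + if x = a ∧ y = b then 1 else 0) u S =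
      cutSlack l u S - if a ∈ S ∧ b ∉ S then 1 else 0 := by
  have hab : (if a ∈ S ∧ b ∉ S then 1 else 0 : ℤ) =
      ∑ x, ∑ y, if x = a ∧ y = b then (if x ∈ S ∧ y ∉ S then 1 else 0) else 0 := by
    simp [ite_and]
  rw [hab]
  clear hab
  unfold cutSlack
  simp only [← sum_sub_distrib]
  refine sum_congr rfl fun x _ => sum_congr rfl fun y _ => ?_
  split_ifs <;> simp_all
  ring

theorem cutSlack_sub_upper (l u : V → V → ℤ) (a b : V) (S : Finset V) :
    cutSlack l (fun x y => u x y - if x = a ∧ y = b then 1 else 0) S =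
      cutSlack l u S - if a ∉ S ∧ b ∈ S then 1 else 0 := by
  have hab : (if a ∉ S ∧ b ∈ S then 1 else 0 : ℤ) =
      ∑ x, ∑ y, if x = a ∧ y = b then (if x ∉ S ∧ y ∈ S then 1 else 0) else 0 := by
    simp [ite_and]
  rw [hab]
  clear hab
  unfold cutSlack
  simp only [← sum_sub_distrib]
  refine sum_congr rfl fun x _ => sum_congr rfl fun y _ => ?_
  split_ifs <;> simp_all

/-- Hoffman's circulation theorem. An arc with distinct bounds can have its lower bound raised or
its upper bound lowered by one: otherwise there would be two sets of slack zero, one left and one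
entered by the arc, which submodularity of the slack forbids. Once the bounds agree, the cut
condition for singletons and their complements is conservation. -/
theorem exists_circulation (l u : V → V → ℤ) (hlu : ∀ x y, l x y ≤ u x y)
    (hcut : ∀ S, 0 ≤ cutSlack l u S) :
    ∃ f : V → V → ℤ, (∀ x y, l x y ≤ f x y ∧ f x y ≤ u x y) ∧
      ∀ v, ∑ y, f v y = ∑ x, f x v := by
  obtain ⟨N, hN⟩ : ∃ N : ℕ, ∑ x, ∑ y, (u x y - l x y) ≤ N :=
    ⟨(∑ x, ∑ y, (u x y - l x y)).toNat, Int.self_le_toNat _⟩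
  induction N generalizing l u with
  | zero =>
    have hnn : ∀ x y, 0 ≤ u x y - l x y := fun x y => sub_nonneg.2 (hlu x y)
    have h0 : ∑ x, ∑ y, (u x y - l x y) = 0 :=
      le_antisymm (by simpa using hN) (sum_nonneg fun x _ => sum_nonneg fun y _ => hnn x y)
    have heq : u = l := by
      funext x y
      rw [sum_eq_zero_iff_of_nonneg fun x _ => sum_nonneg fun y _ => hnn x y] at h0
      have hx := h0 x (mem_univ x)
      rw [sum_eq_zero_iff_of_nonneg fun y _ => hnn x y] at hx
      linarith [hx y (mem_univ y)]
    subst heq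
    refine ⟨u, fun x y => ⟨le_rfl, le_rfl⟩, fun v => ?_⟩
    have h1 := hcut {v}
    have h2 := hcut {v}ᶜ
    rw [cutSlack_compl_of_fun_eq] at h2
    rw [cutSlack_eq_of_fun_eq] at h1 h2
    linarith
  | succ N ih =>
    by_cases hex : ∃ a b, l a b < u a b
    · obtain ⟨a, b, hab⟩ := hex
      have hδ : ∑ x, ∑ y, (if x = a ∧ y = b then 1 else 0 : ℤ) = 1 := by simp [ite_and]
      by_cases hl : ∀ S, 0 ≤ cutSlack (fun x y => l x y + if x = a ∧ y = b then 1 else 0) u S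
      · obtain ⟨f, hf, hc⟩ := ih (fun x y => l x y + if x = a ∧ y = b then 1 else 0) u
          (fun x y => by
            have := hlu x y
            split_ifs with h
            · rw [h.1, h.2]; omega
            · omega) hl (by
            simp only [← sub_sub, sum_sub_distrib] at hN ⊢
            push_cast at hN
            linarith)
        refine ⟨f, fun x y => ⟨le_trans ?_ (hf x y).1, (hf x y).2⟩, hc⟩
        split_ifs <;> omega
      · by_cases hu : ∀ S, 0 ≤ cutSlack l (fun x y => u x y - if x = a ∧ y = b then 1 else 0) S
        · obtain ⟨f, hf, hc⟩ := ih l (fun x y => u x y - if x = a ∧ y = b then 1 else 0)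
            (fun x y => by
              have := hlu x y
              split_ifs with h
              · rw [h.1, h.2]; omega
              · omega) hu (by
              simp only [sub_right_comm, sum_sub_distrib] at hN ⊢
              push_cast at hN
              linarith)
          refine ⟨f, fun x y => ⟨(hf x y).1, le_trans (hf x y).2 ?_⟩, hc⟩
          split_ifs <;> omega
        · exfalso
          push Not at hl hu
          obtain ⟨S, hS⟩ := hl
          obtain ⟨T, hT⟩ := hu
          rw [cutSlack_add_lower] at hS
          rw [cutSlack_sub_upper] at hT
          have hS0 := hcut S
          have hT0 := hcut T
          split_ifs at hS hT with h1 h2 h2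
          · have := cutSlack_inter_add_cutSlack_union_le hlu h1.1 h1.2 h2.1 h2.2
            have := hcut (S ∩ T)
            have := hcut (S ∪ T)
            omega
          all_goals omega
    · push Not at hex
      refine ih l u hlu hcut ?_
      refine le_trans (sum_nonpos fun x _ => sum_nonpos fun y _ => ?_) (Int.natCast_nonneg N)
      linarith [hex x y]

end Circulation

theorem sum_compl_eq_sum_ite {Z : Type*} [Fintype Z] [DecidableEq Z] (J : Finset Z) (h : Z → ℤ) :
    ∑ z ∈ Jᶜ, h z = ∑ z, if z ∈ J then 0 else h z := by
  rw [← sum_add_sum_compl J (fun z => if z ∈ J then 0 else h z),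
    sum_eq_zero (s := J) (fun z hz => if_pos hz), zero_add]
  exact sum_congr rfl fun z hz => (if_neg (mem_compl.1 hz)).symm

theorem sum_eq_sum_ite {Z : Type*} [Fintype Z] [DecidableEq Z] (J : Finset Z) (h : Z → ℤ) :
    ∑ z ∈ J, h z = ∑ z, if z ∈ J then h z else 0 := by
  rw [sum_ite_mem, univ_inter]

/-! ### Integral matrices with prescribed row sums and bounded column sums -/

section Transport

variable {X Y : Type*} [Fintype X] [Fintype Y] [DecidableEq X] [DecidableEq Y]

/-- Feasibility of a transportation problem with capacities `c`, row sums `p` and column sums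
between `g` and `f`: the circulation theorem for the network in which a single extra vertex is
joined to all rows, and all columns are joined to it. -/
theorem exists_matrix_of_cut_conditions (c : X → Y → ℤ) (hc : ∀ x y, 0 ≤ c x y) (p : X → ℤ)
    (g f : Y → ℤ) (hgf : ∀ y, g y ≤ f y)
    (hcol : ∀ K : Finset Y, ∑ y ∈ K, g y ≤ ∑ x, min (p x) (∑ y ∈ K, c x y))
    (hrow : ∀ I : Finset X, ∑ x ∈ I, p x ≤ ∑ y, min (f y) (∑ x ∈ I, c x y)) :
    ∃ B : X → Y → ℤ, (∀ x y, 0 ≤ B x y ∧ B x y ≤ c x y) ∧ (∀ x, ∑ y, B x y = p x) ∧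
      ∀ y, g y ≤ ∑ x, B x y ∧ ∑ x, B x y ≤ f y := by
  let l : Option (X ⊕ Y) → Option (X ⊕ Y) → ℤ
    | none, some (Sum.inl x) => p x
    | some (Sum.inr y), none => g y
    | _, _ => 0
  let u : Option (X ⊕ Y) → Option (X ⊕ Y) → ℤ
    | none, some (Sum.inl x) => p x
    | some (Sum.inl x), some (Sum.inr y) => c x y
    | some (Sum.inr y), none => f y
    | _, _ => 0
  have hlu : ∀ a b, l a b ≤ u a b := by
    rintro (_ | _ | _) (_ | _ | _) <;> simp [l, u, hc, hgf]
  have hcut : ∀ S, 0 ≤ cutSlack l u S := by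
    intro S
    let I : Finset X := univ.filter fun x => some (Sum.inl x) ∈ S
    let K : Finset Y := univ.filter fun y => some (Sum.inr y) ∈ S
    have hI : ∀ x, some (Sum.inl x) ∈ S ↔ x ∈ I := fun x => by simp [I]
    have hK : ∀ y, some (Sum.inr y) ∈ S ↔ y ∈ K := fun y => by simp [K]
    -- Only the arcs at the extra vertex and those from rows outside `I` to columns in `K` count.
    by_cases hs : none ∈ S
    · have hb : ∑ x ∈ Iᶜ, p x ≤ ∑ y ∈ Kᶜ, f y + ∑ x ∈ Iᶜ, ∑ y ∈ K, c x y := by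
        refine (hrow Iᶜ).trans ?_
        rw [sum_comm, ← sum_add_sum_compl K, add_comm]
        exact add_le_add (sum_le_sum fun y _ => min_le_left _ _)
          (sum_le_sum fun y _ => min_le_right _ _)
      simp only [sum_compl_eq_sum_ite, sum_eq_sum_ite K] at hb
      have h1 : ∑ x, (if x ∈ I then 0 else -p x) = -∑ x, if x ∈ I then 0 else p x := by
        rw [← sum_neg_distrib]
        exact sum_congr rfl fun x _ => by split_ifs <;> simp
      have h2 : ∑ x, ∑ y, (if x ∈ I then 0 else if y ∈ K then c x y else 0) =
          ∑ x, if x ∈ I then 0 else ∑ y, if y ∈ K then c x y else 0 :=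
        sum_congr rfl fun x _ => by split_ifs <;> simp
      simp only [cutSlack, Fintype.sum_option, Fintype.sum_sum_type, hs, hI, hK, l, u, if_true,
        neg_zero, ite_self, sum_const_zero, zero_add, add_zero, h1, h2]
      linarith
    · have hb : ∑ y ∈ K, g y ≤ ∑ x ∈ I, p x + ∑ x ∈ Iᶜ, ∑ y ∈ K, c x y := by
        refine (hcol K).trans ?_
        rw [← sum_add_sum_compl I]
        exact add_le_add (sum_le_sum fun y _ => min_le_left _ _)
          (sum_le_sum fun y _ => min_le_right _ _)
      simp only [sum_compl_eq_sum_ite, sum_eq_sum_ite I, sum_eq_sum_ite K] at hb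
      have h1 : ∑ y, (if y ∈ K then -g y else 0) = -∑ y, if y ∈ K then g y else 0 := by
        rw [← sum_neg_distrib]
        exact sum_congr rfl fun x _ => by split_ifs <;> simp
      have h2 : ∑ x, ∑ y, (if x ∈ I then 0 else if y ∈ K then c x y else 0) =
          ∑ x, if x ∈ I then 0 else ∑ y, if y ∈ K then c x y else 0 :=
        sum_congr rfl fun x _ => by split_ifs <;> simp
      simp only [cutSlack, Fintype.sum_option, Fintype.sum_sum_type, hs, hI, hK, l, u,
        if_false, neg_zero, ite_self, sum_const_zero, zero_add, add_zero, h1, h2]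
      linarith
  obtain ⟨F, hF, hcons⟩ := exists_circulation l u hlu hcut
  have hz : ∀ a b, l a b = 0 → u a b = 0 → F a b = 0 := fun a b h1 h2 =>
    le_antisymm (h2 ▸ (hF a b).2) (h1 ▸ (hF a b).1)
  refine ⟨fun x y => F (some (Sum.inl x)) (some (Sum.inr y)), fun x y => hF _ _, fun x => ?_,
    fun y => ?_⟩
  · have h := hcons (some (Sum.inl x))
    have h1 := hF none (some (Sum.inl x))
    simp only [Fintype.sum_option, Fintype.sum_sum_type] at h
    rw [hz (some (Sum.inl x)) none rfl rfl] at h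
    simp only [fun z => hz (some (Sum.inl x)) (some (Sum.inl z)) rfl rfl,
      fun z => hz (some (Sum.inl z)) (some (Sum.inl x)) rfl rfl,
      fun z => hz (some (Sum.inr z)) (some (Sum.inl x)) rfl rfl] at h
    simp only [l, u] at h1
    simp only [sum_const_zero] at h
    linarith
  · have h := hcons (some (Sum.inr y))
    have h1 := hF (some (Sum.inr y)) none
    simp only [Fintype.sum_option, Fintype.sum_sum_type] at h
    rw [hz none (some (Sum.inr y)) rfl rfl] at h
    simp only [fun z => hz (some (Sum.inr y)) (some (Sum.inl z)) rfl rfl,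
      fun z => hz (some (Sum.inr y)) (some (Sum.inr z)) rfl rfl,
      fun z => hz (some (Sum.inr z)) (some (Sum.inr y)) rfl rfl] at h
    simp only [l, u] at h1
    simp only [sum_const_zero] at h
    constructor <;> linarith

/-- Rounding of the fractional matrix `A / m`. It has row sums `p` and column sums at most one,
so its existence gives the cut conditions for an integral matrix with the same row sums, with
column sums at most one, and equal to one where the column sums of `A / m` are. -/
theorem exists_rounding (A : X → Y → ℤ) (hA : ∀ x y, 0 ≤ A x y) {m : ℤ} (hm : 0 < m) (p : X → ℤ)
    (hrow : ∀ x, ∑ y, A x y = m * p x) (hcol : ∀ y, ∑ x, A x y ≤ m) :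
    ∃ B : X → Y → ℤ, (∀ x y, 0 ≤ B x y ∧ B x y ≤ A x y) ∧ (∀ x, ∑ y, B x y = p x) ∧
      ∀ y, ∑ x, B x y ≤ 1 ∧ (∑ x, A x y = m → ∑ x, B x y = 1) := by
  obtain ⟨B, hB, hr, hc⟩ := exists_matrix_of_cut_conditions A hA p
    (fun y => if ∑ x, A x y = m then 1 else 0) (fun _ => 1) (fun y => by split_ifs <;> simp)
    (fun K => by
      refine le_of_mul_le_mul_left ?_ hm
      calc m * ∑ y ∈ K, (if ∑ x, A x y = m then 1 else 0)
          ≤ ∑ y ∈ K, ∑ x, A x y := by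
            rw [mul_sum]
            refine sum_le_sum fun y _ => ?_
            split_ifs with h
            · rw [h, mul_one]
            · rw [mul_zero]
              exact sum_nonneg fun x _ => hA x y
        _ = ∑ x, ∑ y ∈ K, A x y := sum_comm
        _ ≤ m * ∑ x, min (p x) (∑ y ∈ K, A x y) := by
            rw [mul_sum]
            refine sum_le_sum fun x _ => ?_
            have h0 : 0 ≤ ∑ y ∈ K, A x y := sum_nonneg fun y _ => hA x y
            rw [mul_min_of_nonneg _ _ hm.le, ← hrow]
            refine le_min (sum_le_univ_sum_of_nonneg (hA x)) ?_
            nlinarith)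
    (fun I => by
      refine le_of_mul_le_mul_left ?_ hm
      calc m * ∑ x ∈ I, p x = ∑ x ∈ I, ∑ y, A x y := by
            rw [mul_sum]
            exact sum_congr rfl fun x _ => (hrow x).symm
        _ = ∑ y, ∑ x ∈ I, A x y := sum_comm
        _ ≤ m * ∑ y, min 1 (∑ x ∈ I, A x y) := by
            rw [mul_sum]
            refine sum_le_sum fun y _ => ?_
            have h0 : 0 ≤ ∑ x ∈ I, A x y := sum_nonneg fun x _ => hA x y
            have h1 : ∑ x ∈ I, A x y ≤ ∑ x, A x y :=
              sum_le_univ_sum_of_nonneg fun x => hA x y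
            rw [mul_min_of_nonneg _ _ hm.le]
            refine le_min (by linarith [hcol y]) ?_
            nlinarith)
  refine ⟨B, hB, hr, fun y => ⟨(hc y).2, fun h => le_antisymm (hc y).2 ?_⟩⟩
  simpa [h] using (hc y).1

/-- Linear duality for the minimum: a lower bound on a sum of minima is a lower bound for every
choice of one of the two terms in each minimum. -/
theorem le_sum_min_iff (a : ℤ) (f h : Y → ℤ) :
    a ≤ ∑ y, min (f y) (h y) ↔ ∀ K : Finset Y, a ≤ ∑ y ∈ Kᶜ, f y + ∑ y ∈ K, h y := by
  constructor
  · intro H K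
    refine H.trans ?_
    rw [← sum_add_sum_compl K, add_comm]
    exact add_le_add (sum_le_sum fun y _ => min_le_left _ _)
      (sum_le_sum fun y _ => min_le_right _ _)
  · intro H
    refine (H (univ.filter fun y => h y ≤ f y)).trans (le_of_eq ?_)
    rw [← sum_add_sum_compl (univ.filter fun y => h y ≤ f y), add_comm]
    congr 1
    · exact sum_congr rfl fun y hy => (min_eq_right (by simpa using hy)).symm
    · exact sum_congr rfl fun y hy => (min_eq_left (le_of_lt (by simpa using hy))).symm

end Transport

/-- An upper bound on a sum of truncated differences is an upper bound for the differences summed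
over any subset. -/
theorem sum_dotdiv_le_iff {Y : Type*} (b : ℤ) (J : Finset Y) (f h : Y → ℤ) :
    ∑ y ∈ J, dotdiv (f y) (h y) ≤ b ↔ ∀ T ⊆ J, ∑ y ∈ T, f y ≤ b + ∑ y ∈ T, h y := by
  constructor
  · intro H T hT
    have h1 : ∑ y ∈ T, (f y - h y) ≤ ∑ y ∈ T, dotdiv (f y) (h y) :=
      sum_le_sum fun y _ => le_max_right _ _
    have h2 : ∑ y ∈ T, dotdiv (f y) (h y) ≤ ∑ y ∈ J, dotdiv (f y) (h y) :=
      sum_le_sum_of_subset_of_nonneg hT fun y _ _ => le_max_left _ _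
    rw [sum_sub_distrib] at h1
    linarith
  · intro H
    have h1 := H (J.filter fun y => h y ≤ f y) (filter_subset _ _)
    have h2 : ∑ y ∈ J, dotdiv (f y) (h y) = ∑ y ∈ J.filter (fun y => h y ≤ f y), (f y - h y) := by
      rw [sum_filter]
      refine sum_congr rfl fun y _ => ?_
      unfold dotdiv
      split_ifs with hy
      · exact max_eq_right (by linarith)
      · exact max_eq_left (by linarith)
    rw [h2, sum_sub_distrib]
    linarith

/-! ### The three forms of the numerical condition -/

section Conditions

variable {r k : ℕ} (n : ℕ) (ρ : Fin k → ℕ) (L : Matrix (Fin r) (Fin r) (Fin k))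

theorem missingRows_eq_sum (I : Finset (Fin r)) (ℓ : Fin k) :
    (missingRows L I ℓ : ℤ) = ∑ i ∈ I, if IsMissing L i ℓ then 1 else 0 := by
  simp [missingRows]

theorem missingSymbols_eq_sum (K : Finset (Fin k)) (i : Fin r) :
    (missingSymbols L K i : ℤ) = ∑ ℓ ∈ K, if IsMissing L i ℓ then 1 else 0 := by
  simp [missingSymbols]

theorem sum_missingRows_eq_sum_missingSymbols (I : Finset (Fin r)) (K : Finset (Fin k)) :
    ∑ ℓ ∈ K, (missingRows L I ℓ : ℤ) = ∑ i ∈ I, (missingSymbols L K i : ℤ) := by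
  simp only [missingRows_eq_sum, missingSymbols_eq_sum]
  exact sum_comm

theorem dotdiv_nonneg (x y : ℤ) : 0 ≤ dotdiv x y := le_max_left _ _

/-- The row condition as the half of the mixed condition that involves the floors. -/
theorem rowCondition_iff : RowCondition n ρ L ↔ ∀ (I : Finset (Fin r)) (K : Finset (Fin k)),
    ∑ i ∈ I, dotdiv ((n : ℤ) - r) (missingSymbols L K i) ≤
      ∑ ℓ ∈ Kᶜ, ((ρ ℓ : ℤ) - occ L ℓ) / 2 := by
  simp only [RowCondition, le_sum_min_iff, sum_dotdiv_le_iff,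
    sum_missingRows_eq_sum_missingSymbols, sum_const, nsmul_eq_mul, mul_comm ((n : ℤ) - r)]
  exact ⟨fun H I K T _ => H T K, fun H I K => H I K I Subset.rfl⟩

/-- The symbol condition as the half of the mixed condition that involves the numbers of missing
rows. -/
theorem symbolCondition_iff : SymbolCondition n ρ L ↔
    ∀ (I : Finset (Fin r)) (K : Finset (Fin k)),
      ∑ ℓ ∈ K, dotdiv ((ρ ℓ : ℤ) - occ L ℓ - n + r) (missingRows L I ℓ) ≤
        ((n : ℤ) - r) * ((r : ℤ) - I.card) := by
  have hI : ∀ I : Finset (Fin r), ∑ i ∈ Iᶜ, ((n : ℤ) - r) = ((n : ℤ) - r) * ((r : ℤ) - I.card) := by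
    intro I
    rw [sum_const, card_compl, Fintype.card_fin, nsmul_eq_mul, Nat.cast_sub, mul_comm]
    simpa using card_le_univ I
  simp only [SymbolCondition, le_sum_min_iff, sum_dotdiv_le_iff, hI,
    ← sum_missingRows_eq_sum_missingSymbols]
  constructor
  · intro H I K T _
    have h1 := H T I T Subset.rfl
    simp only [sum_add_distrib, sum_sub_distrib] at h1 ⊢
    linarith
  · intro H K I T hT
    have h1 := H I K T hT
    have h2 : ∑ ℓ ∈ T, (missingRows L I ℓ : ℤ) ≤ ∑ ℓ ∈ K, (missingRows L I ℓ : ℤ) :=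
      sum_le_sum_of_subset_of_nonneg hT fun _ _ _ => Int.natCast_nonneg _
    simp only [sum_add_distrib, sum_sub_distrib] at h1 ⊢
    linarith

/-- The mixed condition is the sum of the other two. They are recovered from it by taking all rows,
respectively all symbols, since the remaining sums of truncated differences are nonnegative. -/
theorem mixedCondition_iff :
    MixedCondition n ρ L ↔ RowCondition n ρ L ∧ SymbolCondition n ρ L := by
  rw [rowCondition_iff, symbolCondition_iff]
  constructor
  · intro H
    constructor
    · intro I K
      have h1 := H univ K
      have h2 : 0 ≤ ∑ ℓ ∈ K, dotdiv ((ρ ℓ : ℤ) - occ L ℓ - n + r) (missingRows L univ ℓ) :=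
        sum_nonneg fun _ _ => dotdiv_nonneg _ _
      have h3 : ∑ i ∈ I, dotdiv ((n : ℤ) - r) (missingSymbols L K i) ≤
          ∑ i, dotdiv ((n : ℤ) - r) (missingSymbols L K i) :=
        sum_le_univ_sum_of_nonneg fun _ => dotdiv_nonneg _ _
      simp only [card_univ, Fintype.card_fin, sub_self, mul_zero, zero_add] at h1
      linarith
    · intro I K
      have h1 := H I univ
      have h2 : 0 ≤ ∑ i ∈ I, dotdiv ((n : ℤ) - r) (missingSymbols L univ i) :=
        sum_nonneg fun _ _ => dotdiv_nonneg _ _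
      have h3 : ∑ ℓ ∈ K, dotdiv ((ρ ℓ : ℤ) - occ L ℓ - n + r) (missingRows L I ℓ) ≤
          ∑ ℓ, dotdiv ((ρ ℓ : ℤ) - occ L ℓ - n + r) (missingRows L I ℓ) :=
        sum_le_univ_sum_of_nonneg fun _ => dotdiv_nonneg _ _
      simp only [compl_univ, sum_empty, add_zero] at h1
      linarith
  · rintro ⟨H1, H2⟩ I K
    linarith [H1 I K, H2 I K]

/-- `x i ℓ` prescribes how often the symbol `ℓ` is to occur in the part of row `i` that lies
outside `L`. The lower bound on the column sums of `x` leaves at most `n - r` occurrences of `ℓ`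
for the `n - r` new rows, and the upper bound accounts for the symmetric occurrences. -/
structure IsRowExtension (x : Fin r → Fin k → ℤ) : Prop where
  nonneg : ∀ i ℓ, 0 ≤ x i ℓ
  le : ∀ i ℓ, x i ℓ ≤ if IsMissing L i ℓ then 1 else 0
  row : ∀ i, ∑ ℓ, x i ℓ = (n : ℤ) - r
  lower : ∀ ℓ, (ρ ℓ : ℤ) - occ L ℓ - (n - r) ≤ ∑ i, x i ℓ
  upper : ∀ ℓ, 2 * ∑ i, x i ℓ ≤ (ρ ℓ : ℤ) - occ L ℓ

variable {n ρ L}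

theorem IsRowExtension.rowCondition {x : Fin r → Fin k → ℤ} (h : IsRowExtension n ρ L x) :
    RowCondition n ρ L := by
  intro I
  calc ((n : ℤ) - r) * I.card = ∑ i ∈ I, ∑ ℓ, x i ℓ := by
        simp only [h.row, sum_const, nsmul_eq_mul, mul_comm]
    _ = ∑ ℓ, ∑ i ∈ I, x i ℓ := sum_comm
    _ ≤ _ := by
      refine sum_le_sum fun ℓ _ => le_min ?_ ?_
      · have h1 : ∑ i ∈ I, x i ℓ ≤ ∑ i, x i ℓ := sum_le_univ_sum_of_nonneg fun i => h.nonneg i ℓ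
        have := h.upper ℓ
        omega
      · rw [missingRows_eq_sum]
        exact sum_le_sum fun i _ => h.le i ℓ

theorem IsRowExtension.symbolCondition {x : Fin r → Fin k → ℤ} (h : IsRowExtension n ρ L x) :
    SymbolCondition n ρ L := by
  intro K
  calc ∑ ℓ ∈ K, dotdiv ((ρ ℓ : ℤ) - occ L ℓ + r) n ≤ ∑ ℓ ∈ K, ∑ i, x i ℓ := by
        refine sum_le_sum fun ℓ _ => max_le (sum_nonneg fun i _ => h.nonneg i ℓ) ?_
        linarith [h.lower ℓ]
    _ = ∑ i, ∑ ℓ ∈ K, x i ℓ := sum_comm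
    _ ≤ _ := by
      refine sum_le_sum fun i _ => le_min ?_ ?_
      · rw [← h.row i]
        exact sum_le_univ_sum_of_nonneg (h.nonneg i)
      · rw [missingSymbols_eq_sum]
        exact sum_le_sum fun ℓ _ => h.le i ℓ

theorem exists_isRowExtension (hocc : ∀ ℓ, occ L ℓ ≤ ρ ℓ) (had : IsAdmissible n ρ L)
    (hR : RowCondition n ρ L) (hS : SymbolCondition n ρ L) :
    ∃ x, IsRowExtension n ρ L x := by
  obtain ⟨x, hx, hr, hc⟩ := exists_matrix_of_cut_conditions
    (fun i ℓ => if IsMissing L i ℓ then 1 else 0) (fun i ℓ => by split_ifs <;> simp)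
    (fun _ => (n : ℤ) - r) (fun ℓ => dotdiv ((ρ ℓ : ℤ) - occ L ℓ + r) n)
    (fun ℓ => ((ρ ℓ : ℤ) - occ L ℓ) / 2)
    (fun ℓ => by
      have := had.sub_le ℓ
      have := hocc ℓ
      refine max_le ?_ ?_ <;> omega)
    (fun K => by simpa only [missingSymbols_eq_sum] using hS K)
    (fun I => by
      have := hR I
      simp only [missingRows_eq_sum] at this
      rwa [sum_const, nsmul_eq_mul, mul_comm])
  refine ⟨x, fun i ℓ => (hx i ℓ).1, fun i ℓ => (hx i ℓ).2, hr, fun ℓ => ?_, fun ℓ => ?_⟩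
  · exact le_trans (le_trans (by linarith) (le_max_right _ _)) (hc ℓ).1
  · have := (hc ℓ).2
    omega

end Conditions

/-! ### Necessity -/

section Count

variable {r k : ℕ}

theorem occ_eq_sum {s : ℕ} (L : Matrix (Fin r) (Fin s) (Fin k)) (ℓ : Fin k) :
    (occ L ℓ : ℤ) = ∑ i, ∑ j, if L i j = ℓ then 1 else 0 := by
  rw [← Fintype.sum_prod_type']
  simp [occ]

theorem occ_submatrix_eq_sum {s : ℕ} (L : Matrix (Fin s) (Fin s) (Fin k)) (f : Fin r → Fin s)
    (ℓ : Fin k) :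
    (occ (L.submatrix f f) ℓ : ℤ) = ∑ i, ∑ j, if L (f i) (f j) = ℓ then 1 else 0 :=
  occ_eq_sum _ _

theorem sum_occ (L : Matrix (Fin r) (Fin r) (Fin k)) : ∑ ℓ, (occ L ℓ : ℤ) = (r : ℤ) ^ 2 := by
  simp only [occ_eq_sum]
  rw [sum_comm]
  simp only [sum_comm (s := (univ : Finset (Fin k)))]
  simp [sq]

theorem sum_ite_eq_le_one {α : Type*} [Fintype α] {f : α → Fin k} (hf : Function.Injective f)
    (ℓ : Fin k) : ∑ j, (if f j = ℓ then 1 else 0 : ℤ) ≤ 1 := by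
  rw [sum_boole]
  norm_cast
  exact card_le_one.2 fun a ha b hb => hf (by simp_all)

/-- A symmetric array has an even number of cells off the diagonal with a given symbol. -/
theorem exists_diag_eq_of_odd {D : Matrix (Fin r) (Fin r) (Fin k)} (hD : D.IsSymm) {ℓ : Fin k}
    (hodd : Odd (occ D ℓ)) : ∃ i, D i i = ℓ := by
  by_contra! hne
  refine Nat.not_even_iff_odd.2 hodd ?_
  rw [← ZMod.natCast_eq_zero_iff_even, occ, card_eq_sum_ones, Nat.cast_sum]
  refine sum_involution (fun c _ => c.swap) ?_ ?_ ?_ ?_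
  · intro c _
    decide
  · rintro ⟨i, j⟩ hc _ heq
    simp only [Prod.swap_prod_mk, Prod.mk.injEq] at heq
    obtain ⟨rfl, _⟩ := heq
    simp at hc
    exact hne _ hc
  · rintro ⟨i, j⟩ hc
    simp only [mem_filter, mem_univ, true_and, Prod.fst_swap, Prod.snd_swap] at hc ⊢
    rw [← hD.apply, hc]
  · intro c _
    exact c.swap_swap

theorem sum_modEq_card_odd {Y : Type*} (s : Finset Y) (f : Y → ℤ) :
    ∑ y ∈ s, f y ≡ ((s.filter fun y => ¬ 2 ∣ f y).card : ℤ) [ZMOD 2] := by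
  rw [card_filter]
  push_cast
  refine Int.ModEq.sum fun y _ => ?_
  unfold Int.ModEq
  split_ifs <;> omega

theorem not_modEq_iff (ρ : Fin k → ℕ) (L : Matrix (Fin r) (Fin r) (Fin k)) (ℓ : Fin k) :
    ¬ ρ ℓ ≡ occ L ℓ [MOD 2] ↔ ¬ (2 : ℤ) ∣ (ρ ℓ : ℤ) - occ L ℓ := by
  unfold Nat.ModEq
  omega

theorem oddCount_eq (ρ : Fin k → ℕ) (L : Matrix (Fin r) (Fin r) (Fin k)) :
    oddCount ρ L = (univ.filter fun ℓ => ¬ (2 : ℤ) ∣ (ρ ℓ : ℤ) - occ L ℓ).card := by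
  simp only [oddCount, not_modEq_iff]

end Count

section Necessity

variable {r m k : ℕ} {ρ : Fin k → ℕ} {L' : Matrix (Fin (r + m)) (Fin (r + m)) (Fin k)}

/-- The occurrences of `ℓ` counted by blocks; by symmetry the two off-diagonal blocks contain the
same number of them. -/
theorem occ_block (hsymm : L'.IsSymm) (ℓ : Fin k) :
    (occ L' ℓ : ℤ) = occ (L'.submatrix (Fin.castAdd m) (Fin.castAdd m)) ℓ +
      2 * (∑ i : Fin r, ∑ j : Fin m, if L' (Fin.castAdd m i) (Fin.natAdd r j) = ℓ then 1 else 0) +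
      occ (L'.submatrix (Fin.natAdd r) (Fin.natAdd r)) ℓ := by
  simp only [occ_submatrix_eq_sum, occ_eq_sum L', Fin.sum_univ_add, sum_add_distrib]
  have h : ∑ j : Fin m, ∑ i : Fin r,
        (if L' (Fin.natAdd r j) (Fin.castAdd m i) = ℓ then 1 else 0 : ℤ) =
      ∑ i : Fin r, ∑ j : Fin m, if L' (Fin.castAdd m i) (Fin.natAdd r j) = ℓ then 1 else 0 := by
    rw [sum_comm]
    exact sum_congr rfl fun i _ => sum_congr rfl fun j _ => by rw [hsymm.apply]
  rw [h]
  ring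

/-- Each of the last `m` columns contains `ℓ` at most once. -/
theorem block_le (hcol : ∀ j, Function.Injective fun i => L' i j) (ℓ : Fin k) :
    (∑ i : Fin r, ∑ j : Fin m, if L' (Fin.castAdd m i) (Fin.natAdd r j) = ℓ then 1 else 0 : ℤ) +
      occ (L'.submatrix (Fin.natAdd r) (Fin.natAdd r)) ℓ ≤ m := by
  have h1 : ∑ i : Fin m, ∑ j : Fin m,
        (if L' (Fin.natAdd r i) (Fin.natAdd r j) = ℓ then 1 else 0 : ℤ) =
      ∑ j : Fin m, ∑ i : Fin m, if L' (Fin.natAdd r i) (Fin.natAdd r j) = ℓ then 1 else 0 :=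
    sum_comm
  rw [occ_submatrix_eq_sum, h1, sum_comm, ← sum_add_distrib]
  calc _ ≤ ∑ j : Fin m, (1 : ℤ) := by
        refine sum_le_sum fun j _ => ?_
        have := sum_ite_eq_le_one (hcol (Fin.natAdd r j)) ℓ
        rwa [Fin.sum_univ_add] at this
    _ = m := by simp

theorem IsRhoLatinSquare.isRowExtension (h : IsRhoLatinSquare ρ L') (hsymm : L'.IsSymm) :
    IsRowExtension (r + m) ρ (L'.submatrix (Fin.castAdd m) (Fin.castAdd m)) fun i ℓ =>
      ∑ j : Fin m, if L' (Fin.castAdd m i) (Fin.natAdd r j) = ℓ then 1 else 0 := by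
  refine ⟨fun i ℓ => sum_nonneg fun j _ => by split_ifs <;> simp, fun i ℓ => ?_, fun i => ?_,
    fun ℓ => ?_, fun ℓ => ?_⟩
  · have h1 := sum_ite_eq_le_one (h.row (Fin.castAdd m i)) ℓ
    rw [Fin.sum_univ_add] at h1
    have h0 : ∀ j ∈ (univ : Finset (Fin r)),
        (0 : ℤ) ≤ if L' (Fin.castAdd m i) (Fin.castAdd m j) = ℓ then 1 else 0 :=
      fun j _ => by split_ifs <;> simp
    split_ifs with hmiss
    · linarith [sum_nonneg h0]
    · unfold IsMissing at hmiss
      push Not at hmiss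
      obtain ⟨j, hj⟩ := hmiss
      have h2 := single_le_sum h0 (mem_univ j)
      rw [if_pos (show L' (Fin.castAdd m i) (Fin.castAdd m j) = ℓ from hj)] at h2
      linarith
  · rw [sum_comm]
    simp
  · have h1 := occ_block hsymm ℓ
    have h2 := block_le h.col ℓ
    rw [h.occ_eq] at h1
    push_cast
    linarith
  · have h1 := occ_block hsymm ℓ
    rw [h.occ_eq] at h1
    linarith [Int.natCast_nonneg (occ (L'.submatrix (Fin.natAdd r) (Fin.natAdd r)) ℓ)]

theorem IsRhoLatinSquare.isAdmissible (h : IsRhoLatinSquare ρ L') (hsymm : L'.IsSymm) :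
    IsAdmissible (r + m) ρ (L'.submatrix (Fin.castAdd m) (Fin.castAdd m)) := by
  have hblock := fun ℓ => h.occ_eq ℓ ▸ occ_block hsymm ℓ
  refine ⟨fun ℓ => ?_, ?_, ?_, ?_⟩
  · have h1 := hblock ℓ
    have h2 := block_le h.col ℓ
    have h3 := Int.natCast_nonneg (occ (L'.submatrix (Fin.natAdd r) (Fin.natAdd r)) ℓ)
    push_cast
    linarith
  · have hsub : (univ.filter fun ℓ => ¬ (2 : ℤ) ∣ (ρ ℓ : ℤ) -
          occ (L'.submatrix (Fin.castAdd m) (Fin.castAdd m)) ℓ) ⊆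
        univ.image fun j : Fin m => L' (Fin.natAdd r j) (Fin.natAdd r j) := by
      intro ℓ hℓ
      rw [mem_filter] at hℓ
      obtain ⟨i, hi⟩ := exists_diag_eq_of_odd (hsymm.submatrix (Fin.natAdd r)) (ℓ := ℓ) (by
        rw [← Nat.not_even_iff_odd, even_iff_two_dvd]
        have h1 := hblock ℓ
        intro hd
        omega)
      exact mem_image.2 ⟨i, mem_univ i, hi⟩
    have h1 := (card_le_card hsub).trans card_image_le
    rw [← oddCount_eq, card_univ, Fintype.card_fin] at h1
    push_cast
    linarith
  · have h1 : ∑ ℓ, (ρ ℓ : ℤ) = ((r + m : ℕ) : ℤ) ^ 2 := by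
      rw [← sum_occ L']
      exact sum_congr rfl fun ℓ _ => by rw [h.occ_eq]
    rw [sum_sub_distrib, h1, sum_occ, Int.modEq_iff_dvd]
    push_cast
    -- `(r + m) ^ 2 - r ^ 2 - m = 2 * r * m + m * (m - 1)`
    have h2 : (2 : ℤ) ∣ (m : ℤ) * (m - 1) := (Int.even_mul_pred_self _).two_dvd
    obtain ⟨c, hc⟩ := h2
    exact ⟨c + r * m, by linear_combination hc⟩
  · rw [oddCount_eq]
    exact sum_modEq_card_odd _ _

end Necessity

/-! ### Sufficiency -/

section Sufficiency

variable {r k : ℕ}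

/-- An amalgamated form of a symmetric completion of `L` by `m` rows and columns: `x i ℓ` is the
number of occurrences of `ℓ` in the part of row `i` outside `L`, `t ℓ` the number of its
occurrences on the new part of the diagonal, and `c ℓ` the number of pairs of symmetric cells of
the new bottom right block containing `ℓ` off the diagonal. -/
structure IsAmalgam (m : ℕ) (L : Matrix (Fin r) (Fin r) (Fin k)) (x : Fin r → Fin k → ℤ)
    (c t : Fin k → ℤ) : Prop where
  symm : L.IsSymm
  row_injective : ∀ i, Function.Injective (L i)
  nonneg : ∀ i ℓ, 0 ≤ x i ℓ
  le : ∀ i ℓ, x i ℓ ≤ if IsMissing L i ℓ then 1 else 0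
  row : ∀ i, ∑ ℓ, x i ℓ = m
  pair_nonneg : ∀ ℓ, 0 ≤ c ℓ
  diag_nonneg : ∀ ℓ, 0 ≤ t ℓ
  sum_pair : 2 * ∑ ℓ, c ℓ = m * (m - 1)
  sum_diag : ∑ ℓ, t ℓ = m
  degree_le : ∀ ℓ, ∑ i, x i ℓ + 2 * c ℓ + t ℓ ≤ m

/-- The array `L` bordered symmetrically by `s`, with corner entry `h`. -/
def border (L : Matrix (Fin r) (Fin r) (Fin k)) (s : Fin r → Fin k) (h : Fin k) :
    Matrix (Fin (r + 1)) (Fin (r + 1)) (Fin k) :=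
  Fin.snoc (α := fun _ => Fin (r + 1) → Fin k)
    (fun i => Fin.snoc (α := fun _ => Fin k) (L i) (s i)) (Fin.snoc (α := fun _ => Fin k) s h)

variable {L : Matrix (Fin r) (Fin r) (Fin k)} {s : Fin r → Fin k} {h : Fin k}

@[simp]
theorem border_castSucc_castSucc (i j : Fin r) :
    border L s h i.castSucc j.castSucc = L i j := by simp [border]

@[simp]
theorem border_castSucc_last (i : Fin r) : border L s h i.castSucc (Fin.last r) = s i := by
  simp [border]

@[simp]
theorem border_last_castSucc (j : Fin r) : border L s h (Fin.last r) j.castSucc = s j := by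
  simp [border]

@[simp]
theorem border_last_last : border L s h (Fin.last r) (Fin.last r) = h := by simp [border]

theorem isSymm_border (hL : L.IsSymm) : (border L s h).IsSymm := by
  refine Matrix.IsSymm.ext fun i j => ?_
  cases i using Fin.lastCases <;> cases j using Fin.lastCases <;> simp [hL.apply]

theorem occ_border (ℓ : Fin k) : (occ (border L s h) ℓ : ℤ) =
    occ L ℓ + 2 * (∑ i, if s i = ℓ then 1 else 0) + if h = ℓ then 1 else 0 := by
  simp only [occ_eq_sum, Fin.sum_univ_castSucc, border_castSucc_castSucc, border_castSucc_last,
    border_last_castSucc, border_last_last, sum_add_distrib]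
  ring

theorem isMissing_border_castSucc_iff (i : Fin r) (ℓ : Fin k) :
    IsMissing (border L s h) i.castSucc ℓ ↔ IsMissing L i ℓ ∧ s i ≠ ℓ := by
  simp [IsMissing, Fin.forall_fin_succ']

theorem isMissing_border_last_iff (ℓ : Fin k) :
    IsMissing (border L s h) (Fin.last r) ℓ ↔ (∀ i, s i ≠ ℓ) ∧ h ≠ ℓ := by
  simp [IsMissing, Fin.forall_fin_succ']

theorem snoc_injective {f : Fin r → Fin k} {a : Fin k} (hf : Function.Injective f)
    (ha : ∀ i, f i ≠ a) : Function.Injective (Fin.snoc (α := fun _ => Fin k) f a) := by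
  exact Fin.snoc_injective_iff.2 ⟨hf, by simpa using ha⟩

/-- A nonnegative integral vector with sum one is a unit vector. -/
theorem exists_eq_ite_of_sum_eq_one {f : Fin k → ℤ} (h0 : ∀ ℓ, 0 ≤ f ℓ) (h1 : ∑ ℓ, f ℓ = 1) :
    ∃ a, ∀ ℓ, f ℓ = if a = ℓ then 1 else 0 := by
  obtain ⟨a, -, ha⟩ : ∃ a ∈ univ, 0 < f a := by
    by_contra! hle
    linarith [sum_nonpos hle]
  refine ⟨a, fun ℓ => ?_⟩
  have h2 := add_sum_erase univ f (mem_univ a)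
  have h3 := sum_nonneg fun ℓ (_ : ℓ ∈ univ.erase a) => h0 ℓ
  split_ifs with hℓ
  · rw [← hℓ]; omega
  · have h4 := single_le_sum (fun ℓ _ => h0 ℓ) (mem_erase.2 ⟨Ne.symm hℓ, mem_univ ℓ⟩)
    have := h0 ℓ
    omega

/-- Splitting one row and column off an amalgam. The multiplicities with which a symbol occurs in
the new parts of the old rows, off the diagonal of the new block and on it have column sums
at most `m + 1`; after division by `m + 1` they are rounded to the entries of the new row. -/
theorem IsAmalgam.exists_border {m : ℕ} {x : Fin r → Fin k → ℤ} {c t : Fin k → ℤ}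
    (hA : IsAmalgam (m + 1) L x c t) :
    ∃ (s : Fin r → Fin k) (h : Fin k) (x' : Fin (r + 1) → Fin k → ℤ) (c' t' : Fin k → ℤ),
      IsAmalgam m (border L s h) x' c' t' ∧
      ∀ ℓ, occ (border L s h) ℓ + (2 * ∑ i, x' i ℓ + 2 * c' ℓ + t' ℓ) =
        occ L ℓ + (2 * ∑ i, x i ℓ + 2 * c ℓ + t ℓ) := by
  let A : Option (Option (Fin r)) → Fin k → ℤ
    | none => fun ℓ => 2 * c ℓ
    | some none => t
    | some (some i) => x i
  let p : Option (Option (Fin r)) → ℤ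
    | none => m
    | some none => 1
    | some (some _) => 1
  obtain ⟨B, hB, hBrow, hBcol⟩ := exists_rounding A
    (by
      rintro (_ | _ | i) ℓ
      · have := hA.pair_nonneg ℓ
        simp only [A]; omega
      · exact hA.diag_nonneg ℓ
      · exact hA.nonneg i ℓ)
    (m := (m : ℤ) + 1) (by positivity) p
    (by
      rintro (_ | _ | i)
      · have := hA.sum_pair
        simp only [A, p, ← mul_sum, this]
        push_cast
        ring
      · simpa [A, p] using hA.sum_diag
      · simpa [A, p] using hA.row i)
    (fun ℓ => by
      have := hA.degree_le ℓ
      simp only [Fintype.sum_option, A]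
      push_cast at this
      linarith)
  simp only [Fintype.sum_option, A] at hBcol
  choose s hs using fun i => exists_eq_ite_of_sum_eq_one (fun ℓ => (hB (some (some i)) ℓ).1)
    (hBrow (some (some i)))
  obtain ⟨h, hh⟩ := exists_eq_ite_of_sum_eq_one (fun ℓ => (hB (some none) ℓ).1) (hBrow (some none))
  obtain ⟨w, hw⟩ : ∃ w, B none = w := ⟨_, rfl⟩
  have hwr : ∑ ℓ, w ℓ = m := hw ▸ hBrow none
  have hw0 : ∀ ℓ, 0 ≤ w ℓ := fun ℓ => hw ▸ (hB none ℓ).1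
  have hw2 : ∀ ℓ, w ℓ ≤ 2 * c ℓ := fun ℓ => hw ▸ (hB none ℓ).2
  have hsx : ∀ i ℓ, (if s i = ℓ then 1 else 0) ≤ x i ℓ :=
    fun i ℓ => hs i ℓ ▸ (hB (some (some i)) ℓ).2
  have hht : ∀ ℓ, (if h = ℓ then 1 else 0) ≤ t ℓ := fun ℓ => hh ℓ ▸ (hB (some none) ℓ).2
  simp only [hs, hh, hw] at hBcol
  clear hB hBrow
  have hS0 : ∀ ℓ, ∀ i ∈ (univ : Finset (Fin r)), (0 : ℤ) ≤ if s i = ℓ then 1 else 0 :=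
    fun ℓ i _ => by split_ifs <;> simp
  have hh0 : ∀ ℓ, (0 : ℤ) ≤ if h = ℓ then 1 else 0 := fun ℓ => by split_ifs <;> simp
  have hw1 : ∀ ℓ, w ℓ ≤ 1 := fun ℓ => by linarith [hBcol ℓ, sum_nonneg (hS0 ℓ), hh0 ℓ]
  have hmiss : ∀ i, IsMissing L i (s i) := fun i => by
    have h1 := (hsx i (s i)).trans (hA.le i (s i))
    by_contra hne
    simp [hne] at h1
  have hsinj : Function.Injective s := fun i j hij => by
    by_contra hne
    have h1 := add_le_sum (hS0 (s i)) (mem_univ i) (mem_univ j) hne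
    rw [if_pos rfl, if_pos hij.symm] at h1
    linarith [(hBcol (s i)).1, hw0 (s i), hh0 (s i)]
  have hsh : ∀ i, s i ≠ h := fun i hi => by
    have h1 := single_le_sum (hS0 h) (mem_univ i)
    have h2 := (hBcol h).1
    rw [if_pos hi] at h1
    rw [if_pos rfl] at h2
    linarith [hw0 h]
  have hxs : ∀ ℓ, ∑ i, Fin.snoc (α := fun _ => Fin k → ℤ)
      (fun i ℓ => x i ℓ - if s i = ℓ then 1 else 0) w i ℓ =
      ∑ i, x i ℓ - (∑ i, if s i = ℓ then 1 else 0) + w ℓ := by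
    intro ℓ
    simp [Fin.sum_univ_castSucc]
  refine ⟨s, h, Fin.snoc (α := fun _ => Fin k → ℤ) (fun i ℓ => x i ℓ - if s i = ℓ then 1 else 0) w,
    fun ℓ => c ℓ - w ℓ, fun ℓ => t ℓ - if h = ℓ then 1 else 0,
    ⟨isSymm_border hA.symm, fun i => ?_, fun i ℓ => ?_, fun i ℓ => ?_, fun i => ?_, fun ℓ => ?_,
      fun ℓ => ?_, ?_, ?_, fun ℓ => ?_⟩, fun ℓ => ?_⟩
  · cases i using Fin.lastCases with
    | last => simpa [border] using snoc_injective hsinj hsh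
    | cast i => simpa [border] using snoc_injective (hA.row_injective i) (hmiss i)
  · cases i using Fin.lastCases with
    | last => simpa using hw0 ℓ
    | cast i =>
      rw [Fin.snoc_castSucc]
      exact sub_nonneg.2 (hsx i ℓ)
  · cases i using Fin.lastCases with
    | last =>
      simp only [Fin.snoc_last, isMissing_border_last_iff]
      split_ifs with hm
      · exact hw1 ℓ
      · have h1 := (hBcol ℓ).1
        by_cases hhl : h = ℓ
        · rw [if_pos hhl] at h1
          linarith [sum_nonneg (hS0 ℓ)]
        · have : ∃ i, s i = ℓ := by
            by_contra! hne
            exact hm ⟨hne, hhl⟩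
          obtain ⟨i, hi⟩ := this
          have h2 := single_le_sum (hS0 ℓ) (mem_univ i)
          rw [if_pos hi] at h2
          linarith [hh0 ℓ]
    | cast i =>
      simp only [Fin.snoc_castSucc, isMissing_border_castSucc_iff]
      have h1 := hA.le i ℓ
      by_cases hi : s i = ℓ
      · have : IsMissing L i ℓ := hi ▸ hmiss i
        simpa [hi, this] using h1
      · simpa [hi] using h1
  · cases i using Fin.lastCases with
    | last => simpa using hwr
    | cast i => simp [sum_sub_distrib, hA.row i]
  · have := hw2 ℓ
    have := hw1 ℓ
    have := hA.pair_nonneg ℓ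
    omega
  · exact sub_nonneg.2 (hht ℓ)
  · have := hA.sum_pair
    rw [sum_sub_distrib, mul_sub, this, hwr]
    push_cast
    ring
  · simp [sum_sub_distrib, hA.sum_diag]
  · have h1 := hBcol ℓ
    have h2 := hA.degree_le ℓ
    push_cast at h2
    rw [hxs]
    -- The rounded column sum is one if the degree of `ℓ` is maximal, and nonnegative otherwise.
    by_cases heq : 2 * c ℓ + (t ℓ + ∑ i, x i ℓ) = m + 1
    · have := h1.2 heq
      linarith
    · have := sum_nonneg (hS0 ℓ)
      have := hh0 ℓ
      have := hw0 ℓ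
      have : 2 * c ℓ + (t ℓ + ∑ i, x i ℓ) ≤ m := by omega
      linarith
  · rw [hxs, occ_border]
    ring

/-- Splitting off all rows turns an amalgam into a symmetric latin array extending `L`. -/
theorem IsAmalgam.exists_completion {n m : ℕ} (hn : r + m = n) (hrn : r ≤ n)
    {x : Fin r → Fin k → ℤ} {c t : Fin k → ℤ} (hA : IsAmalgam m L x c t) :
    ∃ L' : Matrix (Fin n) (Fin n) (Fin k), L'.IsSymm ∧ (∀ i, Function.Injective (L' i)) ∧
      L'.submatrix (Fin.castLE hrn) (Fin.castLE hrn) = L ∧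
      ∀ ℓ, (occ L' ℓ : ℤ) = occ L ℓ + (2 * ∑ i, x i ℓ + 2 * c ℓ + t ℓ) := by
  induction m generalizing r c t with
  | zero =>
    subst hn
    refine ⟨L, hA.symm, hA.row_injective, rfl, fun ℓ => ?_⟩
    have h1 := hA.degree_le ℓ
    have h2 := hA.pair_nonneg ℓ
    have h3 := hA.diag_nonneg ℓ
    have h4 := sum_nonneg fun i (_ : i ∈ univ) => hA.nonneg i ℓ
    push_cast at h1
    linarith
  | succ m ih =>
    obtain ⟨s, h, x', c', t', hA', hocc⟩ := hA.exists_border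
    obtain ⟨L', h1, h2, h3, h4⟩ := ih (by omega) (by omega) hA'
    refine ⟨L', h1, h2, ?_, fun ℓ => by rw [h4, hocc]⟩
    ext i j
    have := congrFun (congrFun h3 i.castSucc) j.castSucc
    rw [border_castSucc_castSucc] at this
    rw [← this]
    rfl

/-- A nonnegative integral vector dominates one of any smaller nonnegative sum. -/
theorem exists_le_sum_eq {Y : Type*} [Fintype Y] [DecidableEq Y] {f : Y → ℤ} (hf : ∀ y, 0 ≤ f y)
    (N : ℕ) (hN : N ≤ ∑ y, f y) : ∃ c : Y → ℤ, (∀ y, 0 ≤ c y ∧ c y ≤ f y) ∧ ∑ y, c y = N := by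
  induction N with
  | zero => exact ⟨0, fun y => ⟨le_rfl, hf y⟩, by simp⟩
  | succ N ih =>
    push_cast at hN
    obtain ⟨c, hc, hcN⟩ := ih (by linarith)
    obtain ⟨a, -, ha⟩ : ∃ a ∈ univ, c a < f a := by
      by_contra! hle
      linarith [sum_le_sum hle]
    refine ⟨fun y => c y + if a = y then 1 else 0, fun y => ?_, by simp [sum_add_distrib, hcN]⟩
    have := hc y
    by_cases hy : a = y
    · simp only [if_pos hy]
      subst hy
      omega
    · simpa [hy] using this

theorem IsRowExtension.completesToSymmetric {n : ℕ} (hrn : r ≤ n) {ρ : Fin k → ℕ}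
    (hsum : ∑ ℓ, ρ ℓ = n ^ 2) (hrow : ∀ i, Function.Injective (L i)) (hsymm : L.IsSymm)
    (had : IsAdmissible n ρ L) {x : Fin r → Fin k → ℤ} (hx : IsRowExtension n ρ L x) :
    CompletesToSymmetric hrn ρ L := by
  obtain ⟨m, rfl⟩ := Nat.exists_eq_add_of_le hrn
  -- `d ℓ` is the number of occurrences of `ℓ` required in the new bottom right block.
  obtain ⟨d, hd⟩ : ∃ d : Fin k → ℤ, ∀ ℓ, d ℓ = (ρ ℓ : ℤ) - occ L ℓ - 2 * ∑ i, x i ℓ :=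
    ⟨_, fun _ => rfl⟩
  have hd0 : ∀ ℓ, 0 ≤ d ℓ := fun ℓ => by linarith [hd ℓ, hx.upper ℓ]
  have hsumd : ∑ ℓ, d ℓ = (m : ℤ) ^ 2 := by
    have h1 : ∑ ℓ, (ρ ℓ : ℤ) = ((r + m : ℕ) : ℤ) ^ 2 := by exact_mod_cast hsum
    have h2 : ∑ ℓ, ∑ i, x i ℓ = r * m := by
      rw [sum_comm]
      simp [hx.row]
    simp only [hd, sum_sub_distrib, ← mul_sum, h1, h2, sum_occ]
    push_cast
    ring
  have hmm : 2 * ((m * (m - 1) / 2 : ℕ) : ℤ) = m * (m - 1) := by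
    have h1 : 2 * (m * (m - 1) / 2) = m * (m - 1) :=
      Nat.mul_div_cancel' (Nat.even_mul_pred_self m).two_dvd
    have h2 : ((m * (m - 1) : ℕ) : ℤ) = m * (m - 1) := by
      cases m <;> simp
    exact_mod_cast h2 ▸ congrArg (Nat.cast (R := ℤ)) h1
  -- The symbols of odd multiplicity fill at most `m` diagonal cells, so that the other cells of
  -- the block can be taken off in pairs.
  obtain ⟨c, hc, hcN⟩ := exists_le_sum_eq (f := fun ℓ => d ℓ / 2)
    (fun ℓ => Int.ediv_nonneg (hd0 ℓ) (by norm_num)) (m * (m - 1) / 2) (by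
      have hodd : ∑ ℓ, (if ¬ (2 : ℤ) ∣ d ℓ then 1 else 0 : ℤ) ≤ m := by
        have h1 := had.oddCount_le
        rw [oddCount_eq, card_filter] at h1
        push_cast at h1
        refine le_trans (sum_le_sum fun ℓ _ => ?_) (by linarith)
        have := hd ℓ
        split_ifs <;> omega
      have hdiv : 2 * ∑ ℓ, d ℓ / 2 = ∑ ℓ, d ℓ - ∑ ℓ, (if ¬ (2 : ℤ) ∣ d ℓ then 1 else 0) := by
        rw [mul_sum, ← sum_sub_distrib]
        refine sum_congr rfl fun ℓ _ => ?_
        split_ifs <;> omega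
      have : (m : ℤ) * (m - 1) = m ^ 2 - m := by ring
      linarith)
  have hcN' : 2 * ∑ ℓ, c ℓ = m * (m - 1) := by
    rw [hcN, hmm]
  obtain ⟨L', h1, h2, h3, h4⟩ := IsAmalgam.exists_completion (n := r + m) (L := L) rfl hrn
    (x := x) (c := c) (t := fun ℓ => d ℓ - 2 * c ℓ) (m := m)
    { symm := hsymm
      row_injective := hrow
      nonneg := hx.nonneg
      le := hx.le
      row := fun i => by simpa using hx.row i
      pair_nonneg := fun ℓ => (hc ℓ).1
      diag_nonneg := fun ℓ => by
        have := (hc ℓ).2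
        omega
      sum_pair := hcN'
      sum_diag := by
        rw [sum_sub_distrib, ← mul_sum, hcN', hsumd]
        ring
      degree_le := fun ℓ => by
        have := hx.lower ℓ
        have := hd ℓ
        push_cast at *
        linarith }
  refine ⟨L', ⟨h2, fun j => ?_, fun ℓ => ?_⟩, h1, h3⟩
  · have : (fun i => L' i j) = L' j := funext fun i => h1.apply j i
    rw [this]
    exact h2 j
  · have := h4 ℓ
    have := hd ℓ
    zify
    linarith

end Sufficiency

end RhoLatin

theorem mainTheorem1 {n k r : ℕ} (hn : 0 < n) (hnk : n ≤ k) (hrn : r ≤ n)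
    (ρ : Fin k → ℕ) (hρ : ∀ ℓ, 1 ≤ ρ ℓ ∧ ρ ℓ ≤ n) (hsum : ∑ ℓ, ρ ℓ = n ^ 2)
    (L : Matrix (Fin r) (Fin r) (Fin k))
    (hL : RhoLatin.IsRhoLatinRectangle ρ L) (hsymm : L.IsSymm) :
    (RhoLatin.CompletesToSymmetric hrn ρ L ↔
      RhoLatin.IsAdmissible n ρ L ∧
        (RhoLatin.RowCondition n ρ L ∧ RhoLatin.SymbolCondition n ρ L)) ∧
    (RhoLatin.CompletesToSymmetric hrn ρ L ↔
      RhoLatin.IsAdmissible n ρ L ∧ RhoLatin.MixedCondition n ρ L) ∧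
    (RhoLatin.CompletesToSymmetric hrn ρ L ↔
      RhoLatin.IsAdmissible n ρ L ∧
        ((RhoLatin.RowCondition n ρ L ∧ RhoLatin.SymbolCondition n ρ L) ∨
          RhoLatin.MixedCondition n ρ L)) := by
  have key : RhoLatin.CompletesToSymmetric hrn ρ L ↔ RhoLatin.IsAdmissible n ρ L ∧
      (RhoLatin.RowCondition n ρ L ∧ RhoLatin.SymbolCondition n ρ L) := by
    constructor
    · rintro ⟨L', hL', hsymm', rfl⟩
      obtain ⟨m, rfl⟩ := Nat.exists_eq_add_of_le hrn
      have hx := hL'.isRowExtension hsymm'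
      exact ⟨hL'.isAdmissible hsymm', hx.rowCondition, hx.symbolCondition⟩
    · rintro ⟨had, hR, hS⟩
      obtain ⟨x, hx⟩ := RhoLatin.exists_isRowExtension hL.occ_le had hR hS
      exact hx.completesToSymmetric hrn hsum hL.row hsymm had
  rw [RhoLatin.mixedCondition_iff, or_self]
  exact ⟨key, key, key⟩
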